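/- Assume the Continuum Hypothesis, $2^{\aleph_0}=\aleph_1$. Let $\mathbb{Z}(2)=\mathbb{Z}/2\mathbb{Z}$ carry the discrete topology and let $\mathbb{Z}(2)^{\omega_1}$ carry the product topology and the coordinatewise group operation. Then there exists a subgroup $G$ of $\mathbb{Z}(2)^{\omega_1}$ which, with the subspace topology, is a separable countably compact (Hausdorff) topological abelian group, and which contains a closed subgroup $K$ (closed in $G$) that is not separable. In particular, under CH there exists a separable countably compact topological abelian group with a closed non-separable subgroup. -/

import Mathlib

/-!
Fix a countable infinite set `J` of coordinates. Let `Φ : 2^J → 2^ω₁` be a homomorphism for which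
every injective sequence in `2^J` has an image that is dense in all but countably many coordinates
(an HFD, in the terminology of Hajnal and Juhász). Under CH there are only `ω₁` such sequences, so
`Φ` can be built one coordinate at a time, each coordinate splitting the countably many infinite
sets that matter so far. The group `G` consists of the points `x` of `2^ω₁` which agree with
`Φ (x|J)` off a countable set. A sequence in `G` differs from its image under `Φ` only on a
countable set of coordinates, where it converges along a subsequence; on the remaining coordinates
the HFD property supplies a cluster point. The same density makes `G` separable. Points of `G`
vanishing on `J` agree with `Φ 0 = 0` off a countable set, so a countable set of them vanishes at
a common coordinate, whereas every single coordinate outside `J` is realised: they form a closed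
non-separable subgroup.
-/

open Set Filter Topology TopologicalSpace

theorem exists_fun_of_forall_Iio {I C : Type*} [Preorder I] [WellFoundedLT I]
    (P : (i : I) → (Iio i → C) → C → Prop) (h : ∀ i g, ∃ c, P i g c) :
    ∃ φ : I → C, ∀ i, P i ((Iio i).domRestrict φ) (φ i) := by
  choose c hc using h
  refine ⟨WellFoundedLT.fix fun i g => c i fun j => g j j.2, fun i => ?_⟩
  rw [WellFoundedLT.fix_eq]
  exact hc i _

section Splitting

variable {K V W : Type*} [DivisionRing K] [AddCommGroup V] [Module K V]

theorem linearIndependent_of_notMem_span_Iio {ι : Type*} [LinearOrder ι] {v : ι → V}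
    (hv : ∀ i, v i ∉ Submodule.span K (v '' Iio i)) : LinearIndependent K v := by
  rw [← linearIndepOn_univ_iff, linearIndepOn_iff_linearIndepOn_finset]
  rintro s -
  induction s using Finset.induction_on_max with
  | empty => simp
  | insert i s hi ih =>
    rw [Finset.coe_insert]
    exact ih.insert fun h => hv i (Submodule.span_mono (image_mono hi) h)

theorem finite_span_of_finite [Finite K] {s : Set V} (hs : s.Finite) :
    (Submodule.span K s : Set V).Finite :=
  have := Module.Finite.span_of_finite K hs
  have := Module.finite_of_finite K (M := Submodule.span K s)
  Set.toFinite _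

theorem exists_linearIndependent_mem [Finite K] {ι : Type*} [Countable ι] {A : ι → Set V}
    (hA : ∀ i, (A i).Infinite) : ∃ v : ι → V, LinearIndependent K v ∧ ∀ i, v i ∈ A i := by
  obtain ⟨f, hf⟩ := exists_injective_nat ι
  let _ : LinearOrder ι := LinearOrder.lift' f hf
  have : WellFoundedLT ι := ⟨InvImage.wf f wellFounded_lt⟩
  have hfin : ∀ i : ι, (Iio i).Finite := fun i => (finite_Iio (f i)).preimage hf.injOn
  obtain ⟨v, hv⟩ := exists_fun_of_forall_Iio
    (fun i g x => x ∈ A i \ (Submodule.span K (range g) : Set V)) fun i g => by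
      have := (hfin i).to_subtype
      exact ((hA i).sdiff (finite_span_of_finite (finite_range g))).nonempty
  refine ⟨v, linearIndependent_of_notMem_span_Iio fun i => ?_, fun i => (hv i).1⟩
  rw [← range_domRestrict]
  exact (hv i).2

variable [AddCommGroup W] [Module K W]

theorem exists_linearMap_apply_eq_of_linearIndependent {ι : Type*} {v : ι → V}
    (hv : LinearIndependent K v) (w : ι → W) : ∃ f : V →ₗ[K] W, ∀ i, f (v i) = w i := by
  obtain ⟨g, hg⟩ := (Finsupp.linearCombination K v).exists_leftInverse_of_injective
    (LinearMap.ker_eq_bot.2 hv)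
  refine ⟨Finsupp.linearCombination K w ∘ₗ g, fun i => ?_⟩
  have hgv : g (v i) = Finsupp.single i 1 := by
    simpa using LinearMap.congr_fun hg (Finsupp.single i 1)
  simp [hgv]

theorem exists_linearMap_infinite_inter_fiber [Finite K] [Countable W] {ι : Type*} [Countable ι]
    {A : ι → Set V} (hA : ∀ i, (A i).Infinite) :
    ∃ f : V →ₗ[K] W, ∀ i w, (A i ∩ f ⁻¹' {w}).Infinite := by
  obtain ⟨v, hv, hvA⟩ := exists_linearIndependent_mem (K := K)
    (A := fun j : ι × W × ℕ => A j.1) fun j => hA j.1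
  obtain ⟨f, hf⟩ := exists_linearMap_apply_eq_of_linearIndependent hv fun j => j.2.1
  refine ⟨f, fun i w => infinite_of_injective_forall_mem (f := fun k => v (i, w, k)) ?_ fun k => ?_⟩
  · exact hv.injective.comp fun k l h => by simpa using h
  · exact ⟨hvA (i, w, k), hf (i, w, k)⟩

theorem exists_splitting_family [Finite K] [Countable W] {I : Type*} [LinearOrder I]
    [WellFoundedLT I] {𝒜 : I → Set (Set V)} (hI : ∀ i : I, (Iio i).Countable)
    (h𝒜 : ∀ i, (𝒜 i).Countable) :
    ∃ φ : I → V →ₗ[K] W, ∀ i, ∀ A ∈ 𝒜 i, ∀ (F : Finset I) (x : I → W), (∀ j ∈ F, j < i) →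
      (A ∩ {v | ∀ j ∈ F, φ j v = x j}).Infinite →
        (A ∩ {v | ∀ j ∈ insert i F, φ j v = x j}).Infinite := by
  let cylinder (i : I) (g : Iio i → V →ₗ[K] W) (σ : (F : Finset (Iio i)) × (F → W)) : Set V :=
    {v | ∀ j : σ.1, g j v = σ.2 j}
  obtain ⟨φ, hφ⟩ := exists_fun_of_forall_Iio
    (fun i g (f : V →ₗ[K] W) => ∀ A ∈ 𝒜 i, ∀ σ, (A ∩ cylinder i g σ).Infinite →
      ∀ w, (A ∩ cylinder i g σ ∩ f ⁻¹' {w}).Infinite) fun i g => by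
    have := (hI i).to_subtype
    have := (h𝒜 i).to_subtype
    obtain ⟨f, hf⟩ := exists_linearMap_infinite_inter_fiber (K := K) (W := W)
      (A := fun p : {p : 𝒜 i × _ // (p.1.1 ∩ cylinder i g p.2).Infinite} =>
        p.1.1.1 ∩ cylinder i g p.1.2) fun p => p.2
    exact ⟨f, fun A hA σ hσ w => hf ⟨(⟨A, hA⟩, σ), hσ⟩ w⟩
  refine ⟨φ, fun i A hA F x hF hinf => ?_⟩
  let σ : (F : Finset (Iio i)) × (F → W) := ⟨F.subtype (· ∈ Iio i), fun j => x j⟩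
  have hcylinder : cylinder i ((Iio i).domRestrict φ) σ = {v | ∀ j ∈ F, φ j v = x j} := by
    ext v
    simp only [cylinder, σ, mem_ofPred_eq, domRestrict_apply, Subtype.forall, Finset.mem_subtype]
    exact ⟨fun h j hj => h j (hF j hj) hj, fun h j _ hj => h j hj⟩
  rw [← hcylinder] at hinf
  refine (hφ i A hA σ hinf (x i)).mono ?_
  rw [hcylinder]
  rintro v ⟨⟨hvA, hvF⟩, hvi⟩
  exact ⟨hvA, (Finset.forall_mem_insert _ _ _).2 ⟨hvi, hvF⟩⟩

end Splitting

instance {I : Type*} : CountableInterFilter (cocountable : Filter I) :=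
  CardinalInterFilter.toCountableInterFilter _ Cardinal.aleph0_lt_aleph_one

instance {I : Type*} [Uncountable I] : (cocountable : Filter I).NeBot := by
  rw [neBot_iff, Ne, ← empty_mem_iff_bot, mem_cocountable, compl_empty]
  exact not_countable_univ

theorem eventually_cocountable_notMem {I : Type*} {C : Set I} (hC : C.Countable) :
    ∀ᶠ i in cocountable, i ∉ C :=
  mem_cocountable.2 ((compl_compl C).symm ▸ hC)

theorem mapClusterPt_prodMk_of_tendsto {α X Y : Type*} [TopologicalSpace X] [TopologicalSpace Y]
    {l : Filter α} {f : α → X} {g : α → Y} {x : X} {y : Y} (hf : Tendsto f l (𝓝 x))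
    (hg : MapClusterPt y l g) : MapClusterPt (x, y) l fun a => (f a, g a) := by
  rw [mapClusterPt_iff_frequently]
  intro s hs
  obtain ⟨t, ht, u, hu, htu⟩ := mem_nhds_prod_iff.1 hs
  exact ((hg.frequently hu).and_eventually (hf ht)).mono fun a ha => htu ⟨ha.2, ha.1⟩

theorem mapClusterPt_pi_iff_of_discrete {I X α : Type*} [TopologicalSpace X] [DiscreteTopology X]
    {l : Filter α} {u : α → I → X} {x : I → X} :
    MapClusterPt x l u ↔ ∀ F : Finset I, ∃ᶠ a in l, ∀ i ∈ F, u a i = x i := by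
  rw [mapClusterPt_iff_frequently]
  constructor
  · intro h F
    refine h {y | ∀ i ∈ F, y i = x i} ((Filter.eventually_all_finset F).2 fun i _ => ?_)
    exact (continuous_apply i).continuousAt.eventually ((isOpen_discrete {x i}).mem_nhds rfl)
  · intro h s hs
    rw [nhds_pi, mem_pi'] at hs
    obtain ⟨F, t, ht, hts⟩ := hs
    exact (h F).mono fun a ha => hts fun i hi => by
      rw [ha i hi]; exact mem_of_mem_nhds (ht i)

instance perfectSpace_pi {J : Type*} [Infinite J] {X : J → Type*} [∀ j, TopologicalSpace (X j)]
    [∀ j, Nontrivial (X j)] : PerfectSpace (∀ j, X j) := by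
  classical
  refine perfectSpace_iff_forall_not_isolated.2 fun x => ?_
  choose c hc using fun j => exists_ne (x j)
  have hlim : Tendsto (fun j => Function.update x j (c j)) cofinite (𝓝[≠] x) := by
    refine tendsto_nhdsWithin_iff.2 ⟨tendsto_pi_nhds.2 fun i => ?_, .of_forall fun j h => ?_⟩
    · refine tendsto_nhds_of_eventually_eq ((eventually_cofinite_ne i).mono fun j hj => ?_)
      exact Function.update_of_ne hj.symm _ _
    · exact hc j (by simpa using congrFun h j)
  exact hlim.neBot

/-- The Hajnal–Juhász notion of an HFD for the family `Φ` of points of the power `X ^ I`: every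
injective sequence from the family is dense in all but countably many coordinates. The values `q`
on the exceptional set `C` are kept in the definition, so that it yields cluster points in `X ^ I`
itself and not just in `X ^ Cᶜ`. -/
def HereditarilyFinallyDense {V I X : Type*} [TopologicalSpace X] (Φ : V → I → X) : Prop :=
  ∀ h : ℕ ↪ V, ∃ C : Set I, C.Countable ∧
    ∃ q : I → X, ∀ x, EqOn x q C → MapClusterPt x atTop (Φ ∘ h)

theorem frequently_atTop_mem_iff_infinite {V : Type*} (h : ℕ ↪ V) {s : Set V} :
    (∃ᶠ n in atTop, h n ∈ s) ↔ (range h ∩ s).Infinite := by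
  rw [Nat.frequently_atTop_iff_infinite, ← image_preimage_eq_range_inter,
    infinite_image_iff h.injective.injOn]
  rfl

theorem exists_linearMap_hereditarilyFinallyDense {K V W I : Type*} [DivisionRing K] [Finite K]
    [AddCommGroup V] [Module K V] [AddCommGroup W] [Module K W] [Finite W] [TopologicalSpace W]
    [DiscreteTopology W] [LinearOrder I] [WellFoundedLT I] (hI : ∀ i : I, (Iio i).Countable)
    (e : (ℕ ↪ V) ↪ I) : ∃ Φ : V →ₗ[K] I → W, HereditarilyFinallyDense Φ := by
  have hcountable (i : I) : ((fun h : ℕ ↪ V => range h) '' (e ⁻¹' Iic i)).Countable := by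
    rw [← Iio_insert]
    exact (((hI i).insert i).preimage e.injective).image _
  obtain ⟨φ, hφ⟩ := exists_splitting_family (K := K) (W := W) hI hcountable
  refine ⟨LinearMap.pi φ, fun h => ⟨Iio (e h), hI _, ?_⟩⟩
  have hcluster {x : I → W} : MapClusterPt x atTop (LinearMap.pi φ ∘ h) ↔
      ∀ F : Finset I, (range h ∩ {v | ∀ i ∈ F, φ i v = x i}).Infinite := by
    simp only [mapClusterPt_pi_iff_of_discrete, ← frequently_atTop_mem_iff_infinite]
    rfl
  obtain ⟨q, hq⟩ : ∃ q, MapClusterPt q atTop (LinearMap.pi φ ∘ h) :=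
    exists_clusterPt_of_compactSpace _
  refine ⟨q, fun x hx => hcluster.2 fun F => ?_⟩
  -- Coordinates below `e h` follow the cluster point `q`; those from `e h` on split `range h`.
  induction F using Finset.induction_on_max with
  | empty => simpa using hcluster.1 hq ∅
  | insert i F hi ih =>
    rcases lt_or_ge i (e h) with hie | hei
    · have hFe : ∀ j ∈ insert i F, x j = q j :=
        (Finset.forall_mem_insert _ _ _).2 ⟨hx hie, fun j hj => hx ((hi j hj).trans hie)⟩
      convert hcluster.1 hq (insert i F) using 6 with v j hj
      rw [hFe j hj]
    · exact hφ i _ (mem_image_of_mem _ hei) F x hi ih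

namespace HereditarilyFinallyDense

variable {V I X : Type*} [TopologicalSpace X] [TopologicalSpace V] {Φ : V → I → X}

theorem exists_mapClusterPt_of_tendsto [T2Space V] (hΦ : HereditarilyFinallyDense Φ) {h : ℕ → V}
    {v : V} (hv : Tendsto h atTop (𝓝 v)) :
    ∃ q, q =ᶠ[cocountable] Φ v ∧ MapClusterPt q atTop (Φ ∘ h) := by
  classical
  obtain ⟨g, hconst | hinj⟩ := exists_increasing_or_nonincreasing_subseq (· = ·) h
  all_goals have hg : Tendsto g atTop atTop := g.strictMono.tendsto_atTop
  · have hgv : h ∘ g = fun _ => h (g 0) := by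
      ext n
      rcases n.eq_zero_or_pos with rfl | hn
      exacts [rfl, (hconst 0 n hn).symm]
    have hv0 : h (g 0) = v := tendsto_nhds_unique tendsto_const_nhds (hgv ▸ hv.comp hg)
    refine ⟨Φ v, .rfl, .of_comp hg ?_⟩
    rw [Function.comp_assoc, hgv, hv0]
    exact tendsto_const_nhds.mapClusterPt
  · obtain ⟨C, hC, q, hq⟩ := hΦ ⟨h ∘ g, .of_lt_imp_ne hinj⟩
    refine ⟨C.piecewise q (Φ v), ?_, (hq _ (piecewise_eqOn ..)).of_comp hg⟩
    filter_upwards [eventually_cocountable_notMem hC] with i hi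
    exact piecewise_eq_of_notMem _ _ _ hi

theorem exists_denseRange_graph [SecondCountableTopology V] [T1Space V] [PerfectSpace V]
    (hΦ : HereditarilyFinallyDense Φ) : ∃ (C : Set I) (D : Set V), C.Countable ∧ D.Countable ∧
      DenseRange fun v : D => (v.1, Cᶜ.domRestrict (Φ v)) := by
  classical
  have hinf (U : countableBasis V) : U.1.Infinite := by
    obtain ⟨v, hv⟩ := nonempty_of_mem_countableBasis U.2
    exact infinite_of_mem_nhds v ((isOpen_of_mem_countableBasis U.2).mem_nhds hv)
  let h (U : countableBasis V) : ℕ ↪ V := ((hinf U).natEmbedding _).trans (.subtype _)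
  have hmem (U : countableBasis V) (n : ℕ) : h U n ∈ U.1 := ((hinf U).natEmbedding _ n).2
  choose C hC q hq using fun U => hΦ (h U)
  have := (countable_countableBasis V).to_subtype
  refine ⟨⋃ U, C U, ⋃ U, range (h U), countable_iUnion hC,
    countable_iUnion fun U => countable_range _, fun p => mem_closure_iff_nhds.2 fun s hs => ?_⟩
  obtain ⟨t, ht, u, hu, htu⟩ := mem_nhds_prod_iff.1 hs
  obtain ⟨U, hU, -, hUt⟩ := (isBasis_countableBasis V).mem_nhds_iff.1 ht
  let x : I → X := fun i => if hi : i ∈ ⋃ U, C U then q ⟨U, hU⟩ i else p.2 ⟨i, hi⟩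
  have hxq : EqOn x (q ⟨U, hU⟩) (C ⟨U, hU⟩) := fun i hi => dif_pos (mem_iUnion_of_mem _ hi)
  have hxp : (⋃ U, C U)ᶜ.domRestrict x = p.2 := funext fun i => dif_neg i.2
  obtain ⟨n, hn⟩ := ((hq _ x hxq).frequently
    ((Pi.continuous_domRestrict _).continuousAt (hxp.symm ▸ hu))).exists
  exact ⟨_, htu ⟨hUt (hmem ⟨U, hU⟩ n), hn⟩,
    ⟨h ⟨U, hU⟩ n, mem_iUnion_of_mem _ (mem_range_self n)⟩, rfl⟩

end HereditarilyFinallyDense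

section Glue

variable {I X : Type*} {J C : Set I}

open scoped Classical in
/-- The point of `X^I` given by `v` on `J`, by `w` on `C \ J` and by `z` elsewhere;
on `J ∩ C` the values of `w` are ignored, so that the definition makes sense for all `J` and `C`. -/
noncomputable def glue (v : J → X) (w : C → X) (z : ↥Cᶜ → X) : I → X := fun i =>
  if hJ : i ∈ J then v ⟨i, hJ⟩ else if hC : i ∈ C then w ⟨i, hC⟩ else z ⟨i, hC⟩

theorem domRestrict_glue (v : J → X) (w : C → X) (z : ↥Cᶜ → X) :
    J.domRestrict (glue v w z) = v :=
  funext fun j => dif_pos j.2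

theorem glue_apply_of_notMem {i : I} (hJ : i ∉ J) (hC : i ∉ C) (v : J → X) (w : C → X)
    (z : ↥Cᶜ → X) : glue v w z i = z ⟨i, hC⟩ := by
  rw [glue, dif_neg hJ, dif_neg hC]

theorem glue_eq_self {x : I → X} {z : ↥Cᶜ → X} (hz : ∀ i : ↥Cᶜ, i.1 ∉ J → z i = x i) :
    glue (J.domRestrict x) (C.domRestrict x) z = x := by
  ext i
  unfold glue
  split_ifs with hJ hC
  exacts [rfl, rfl, hz ⟨i, hC⟩ hJ]

theorem continuous_glue [TopologicalSpace X] :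
    Continuous fun p : ((J → X) × (C → X)) × (↥Cᶜ → X) => glue p.1.1 p.1.2 p.2 := by
  refine continuous_pi fun i => ?_
  unfold glue
  split_ifs <;> fun_prop

end Glue

theorem not_separableSpace_of_eventuallyEq_zero {I X Y : Type*} [TopologicalSpace X] [T1Space X]
    [Zero X] [TopologicalSpace Y] {f : Y → I → X} (hf : Continuous f)
    (hzero : ∀ y, f y =ᶠ[cocountable] 0) (hne : ∃ᶠ i in cocountable, ∃ y, f y i ≠ 0) :
    ¬ SeparableSpace Y := by
  intro _
  obtain ⟨s, hs, hdense⟩ := exists_countable_dense Y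
  obtain ⟨i, hi, his⟩ :=
    (hne.and_eventually ((eventually_countable_ball hs).2 fun y _ => hzero y)).exists
  have hopen : IsOpen {y | f y i ≠ 0} :=
    isOpen_compl_singleton.preimage ((continuous_apply i).comp hf)
  obtain ⟨y, hy, hys⟩ := hdense.inter_open_nonempty _ hopen hi
  exact hy (his y hys)

section AlmostGraph

variable {I M : Type*} {J : Set I} [AddGroup M]

/-- The subgroup of those points of `M ^ I` that agree, off a countable set of coordinates, with the
image under `Φ` of their own restriction to `J`: up to countable modifications outside `J`, the
graph of `Φ`. -/
def almostGraph (Φ : (J → M) →+ (I → M)) : AddSubgroup (I → M) where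
  carrier := {x | x =ᶠ[cocountable] Φ (J.domRestrict x)}
  zero_mem' := mem_ofPred.2 (map_zero Φ).symm.eventuallyEq
  add_mem' hx hy := mem_ofPred.2 <|
    (EventuallyEq.add hx.out hy.out).trans (map_add Φ _ _).symm.eventuallyEq
  neg_mem' hx := mem_ofPred.2 <| (EventuallyEq.neg hx.out).trans (map_neg Φ _).symm.eventuallyEq

variable {Φ : (J → M) →+ (I → M)}

theorem mem_almostGraph {x : I → M} :
    x ∈ almostGraph Φ ↔ x =ᶠ[cocountable] Φ (J.domRestrict x) :=
  Iff.rfl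

theorem glue_mem_almostGraph (hJ : J.Countable) {C : Set I} (hC : C.Countable) (v : J → M)
    (w : C → M) {q : I → M} (hq : q =ᶠ[cocountable] Φ v) :
    glue v w (Cᶜ.domRestrict q) ∈ almostGraph Φ := by
  rw [mem_almostGraph, domRestrict_glue]
  filter_upwards [hq, eventually_cocountable_notMem hJ, eventually_cocountable_notMem hC]
    with i hi hiJ hiC
  rwa [glue_apply_of_notMem hiJ hiC]

variable [TopologicalSpace M]

theorem countablyCompactSpace_almostGraph [CompactSpace M] [T2Space M] [FirstCountableTopology M]
    (hJ : J.Countable) (hΦ : HereditarilyFinallyDense Φ) :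
    CountablyCompactSpace (almostGraph Φ) := by
  refine isCountablyCompact_iff_countablyCompactSpace.1 (.of_seq_clusterPt fun g hg => ?_)
  have hgood : ∀ᶠ i in cocountable, ∀ n, g n ∈ almostGraph Φ → g n i = Φ (J.domRestrict (g n)) i :=
    eventually_countable_forall.2 fun n => eventually_imp_distrib_left.2 id
  obtain ⟨C, hC, hgC⟩ : ∃ C : Set I, C.Countable ∧
      ∀ i ∉ C, ∀ n, g n ∈ almostGraph Φ → g n i = Φ (J.domRestrict (g n)) i :=
    ⟨_, mem_cocountable.1 hgood, fun i hi => not_not.1 hi⟩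
  have := hJ.to_subtype
  have := hC.to_subtype
  obtain ⟨⟨v, w⟩, ψ, hψ, hlim⟩ :=
    CompactSpace.tendsto_subseq fun n => (J.domRestrict (g n), C.domRestrict (g n))
  obtain ⟨q, hqv, hq⟩ := hΦ.exists_mapClusterPt_of_tendsto hlim.fst_nhds
  refine ⟨glue v w (Cᶜ.domRestrict q), glue_mem_almostGraph hJ hC v w hqv,
    .of_comp hψ.tendsto_atTop ?_⟩
  have hcluster := (mapClusterPt_prodMk_of_tendsto hlim
    (hq.continuousAt_comp (Pi.continuous_domRestrict Cᶜ).continuousAt)).continuousAt_comp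
    continuous_glue.continuousAt
  refine hcluster.congrFun ?_
  filter_upwards [hψ.tendsto_atTop.eventually hg] with n hn
  exact glue_eq_self fun i _ => (hgC i i.2 _ hn).symm

theorem separableSpace_almostGraph [Infinite J] [T1Space M] [SecondCountableTopology M]
    [Nontrivial M] (hJ : J.Countable) (hΦ : HereditarilyFinallyDense Φ) :
    SeparableSpace (almostGraph Φ) := by
  have := hJ.to_subtype
  obtain ⟨C, D, hC, hD, hdense⟩ := hΦ.exists_denseRange_graph
  have := hC.to_subtype
  have := hD.to_subtype
  let y (p : D × ℕ) : almostGraph Φ :=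
    ⟨glue p.1.1 (denseSeq (C → M) p.2) (Cᶜ.domRestrict (Φ p.1)),
      glue_mem_almostGraph hJ hC _ _ .rfl⟩
  have hy : DenseRange fun p => (y p : I → M) := by
    have hsurj : Function.Surjective
        fun p : ((J → M) × (↥Cᶜ → M)) × (C → M) => glue p.1.1 p.2 p.1.2 :=
      fun x => ⟨((J.domRestrict x, Cᶜ.domRestrict x), C.domRestrict x), glue_eq_self fun _ _ => rfl⟩
    refine hsurj.denseRange.comp (hdense.prodMap (denseRange_denseSeq (C → M))) ?_
    exact continuous_glue.comp (g := fun p : ((J → M) × (C → M)) × (↥Cᶜ → M) => _)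
      (f := fun p : ((J → M) × (↥Cᶜ → M)) × (C → M) => ((p.1.1, p.2), p.1.2)) (by fun_prop)
  refine ⟨range y, countable_range y, IsInducing.subtypeVal.dense_iff.2 fun x => ?_⟩
  rw [← range_comp]
  exact hy x

theorem exists_isClosed_not_separableSpace_almostGraph [Uncountable I] [T1Space M] [Nontrivial M]
    (hJ : J.Countable) :
    ∃ K : AddSubgroup (almostGraph Φ),
      IsClosed (K : Set (almostGraph Φ)) ∧ ¬ SeparableSpace K := by
  classical
  let π : almostGraph Φ →+ (J → M) :=
    (AddMonoidHom.pi fun j : J => Pi.evalAddMonoidHom _ j.1).comp (almostGraph Φ).subtype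
  have hπ : Continuous π := (Pi.continuous_domRestrict J).comp continuous_subtype_val
  refine ⟨π.ker, isClosed_singleton.preimage hπ, not_separableSpace_of_eventuallyEq_zero
    (f := fun x : π.ker => (x : I → M)) (by fun_prop) (fun x => ?_) (Eventually.frequently ?_)⟩
  · have hx : J.domRestrict (x : I → M) = 0 := x.2
    simpa only [hx, map_zero] using mem_almostGraph.1 x.1.2
  · obtain ⟨m, hm⟩ := exists_ne (0 : M)
    filter_upwards [eventually_cocountable_notMem hJ] with i hi
    have hres : J.domRestrict (Pi.single i m : I → M) = 0 :=
      funext fun j => Pi.single_eq_of_ne (M := fun _ => M) (ne_of_mem_of_not_mem j.2 hi) m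
    have hmem : Pi.single i m ∈ almostGraph Φ := by
      rw [mem_almostGraph, hres, map_zero]
      exact (eventually_cocountable_notMem (countable_singleton i)).mono fun k hk =>
        Pi.single_eq_of_ne (M := fun _ => M) hk m
    exact ⟨⟨⟨_, hmem⟩, hres⟩, by simpa using hm⟩

end AlmostGraph

theorem countable_Iio_omega_one (i : (Ordinal.omega.{0} 1).ToType) : (Iio i).Countable := by
  rw [← Cardinal.le_aleph0_iff_set_countable, ← Cardinal.lt_aleph_one_iff]
  simpa [Cardinal.mk_toType, Ordinal.card_omega] using Cardinal.mk_Iio_lt i (by simp)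

instance uncountable_omega_one : Uncountable (Ordinal.omega.{0} 1).ToType := by
  rw [← Cardinal.aleph0_lt_mk_iff, Cardinal.mk_toType, Ordinal.card_omega]
  exact Cardinal.aleph0_lt_aleph_one

theorem mk_arrow_le_continuum {α X : Type*} [Countable α]
    (hX : Cardinal.mk X ≤ Cardinal.continuum) : Cardinal.mk (α → X) ≤ Cardinal.continuum := by
  rw [Cardinal.mk_arrow, ← Cardinal.continuum_power_aleph0]
  exact (Cardinal.power_le_power_right (Cardinal.lift_le_continuum.2 hX)).trans
    (Cardinal.power_le_power_left Cardinal.continuum_ne_zero (by simp))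

theorem mainTheorem10_general (CH : Cardinal.continuum.{0} = Cardinal.aleph.{0} 1)
    (K : Type*) {W : Type*} [DivisionRing K] [AddCommGroup W] [Module K W] [Finite W] [Nontrivial W]
    [TopologicalSpace W] [DiscreteTopology W] :
    ∃ G : AddSubgroup ((Ordinal.omega.{0} 1).ToType → W),
      SeparableSpace G ∧ CountablyCompactSpace G ∧
        ∃ H : AddSubgroup G, IsClosed (H : Set G) ∧ ¬ SeparableSpace H := by
  obtain ⟨w, hw⟩ := exists_ne (0 : W)
  have : Finite K := .of_injective (fun k => k • w) (smul_left_injective K hw)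
  let a := Infinite.natEmbedding (Ordinal.omega.{0} 1).ToType
  have hJ : (range a).Countable := countable_range a
  have : Infinite (range a) := (infinite_range_of_injective a.injective).to_subtype
  have := hJ.to_subtype
  obtain ⟨e⟩ : Nonempty ((ℕ ↪ range a → W) ↪ (Ordinal.omega.{0} 1).ToType) := by
    rw [← Cardinal.lift_mk_le', Cardinal.mk_toType, Ordinal.card_omega, ← CH]
    have hW : Cardinal.mk W ≤ Cardinal.continuum := Cardinal.mk_le_aleph0.trans
      Cardinal.aleph0_le_continuum
    simpa using (Cardinal.mk_embedding_le_arrow ℕ (range a → W)).trans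
      (mk_arrow_le_continuum (mk_arrow_le_continuum hW))
  obtain ⟨Φ, hΦ⟩ := exists_linearMap_hereditarilyFinallyDense (K := K) (W := W)
    countable_Iio_omega_one e
  exact ⟨almostGraph Φ.toAddMonoidHom, separableSpace_almostGraph hJ hΦ,
    countablyCompactSpace_almostGraph hJ hΦ, exists_isClosed_not_separableSpace_almostGraph hJ⟩

theorem mainTheorem10 (CH : Cardinal.continuum.{0} = Cardinal.aleph.{0} 1) :
    ∃ G : AddSubgroup ((Ordinal.omega.{0} 1).ToType → ZMod 2),
      TopologicalSpace.SeparableSpace G ∧ CountablyCompactSpace G ∧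
        ∃ K : AddSubgroup G,
          IsClosed (K : Set G) ∧ ¬ TopologicalSpace.SeparableSpace K :=
  mainTheorem10_general CH (ZMod 2)
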